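/- Let $s,N\ge 0$ be integers and let $X=\{a_1,\dots,a_N\}$ be a finite multiset of vectors of $\mathbf Z^s$ that spans $\mathbf R^s$ and has no nontrivial nonnegative relation: if $u_1,\dots,u_N\ge 0$ are real and $\sum_i u_ia_i=0$, then all $u_i=0$ (in particular all $a_i\neq 0$). For $x\in\mathbf Z^s$ let $$t_X(x)=\#\Big\{\beta\in\mathbf N^N:\ \sum_{i=1}^N\beta_ia_i=x\Big\},$$ where $\mathbf N=\{0,1,2,\dots\}$. For a finite family $A$ in $\mathbf Z^s$ and $c\in\mathbf Z^s$ put $\Lambda_A^+(c)=\{c+\sum_{a\in A}\alpha_a a:\alpha_a\in\mathbf N\}$, $\Lambda_A^+=\Lambda_A^+(0)$ and $C(A)=\{\sum_{a\in A}\alpha_a a:\alpha_a\in\mathbf R,\ \alpha_a\ge0\}$. Then $t_X(x)$ is finite for every $x\in\mathbf Z^s$, and there are finitely many triples $(A_j,c_j,p_j)$, $j=1,\dots,m$, where $A_j$ is a basis of $\mathbf R^s$ consisting of nonnegative integral multiples of vectors of $X$, $c_j\in\Lambda_X^+$ (so that $\Lambda_{A_j}^+(c_j)\subseteq\Lambda_X^+$),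 and $p_j$ is a nonzero real polynomial in $s$ variables of total degree exactly $N-s$, such that $$t_X(x)=\sum_{j:\ x\in\Lambda_{A_j}^+(c_j)}p_j(x)\qquad\text{for all }x\in\mathbf Z^s .$$ Moreover, $t_X$ is a periodic piecewise polynomial with respect to these shifted cones: there is an integer $d\ge1$ such that for every $S\subseteq\{1,\dots,m\}$ there are real polynomials $P_{S,r}$, $r\in(\mathbf Z/d\mathbf Z)^s$, of degree at most $N-s$, with $t_X(x)=P_{S,\,x\bmod d}(x)$ for every $x\in\mathbf Z^s$ for which $\{j: x\in c_j+C(A_j)\}=S$. -/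

import Mathlib

namespace DiscreteTruncatedPower

/-- An integer vector viewed in `ℝ^s`. -/
def toReal {s : ℕ} (v : Fin s → ℤ) : Fin s → ℝ := fun k => (v k : ℝ)

/-- The nonnegative integral representations of `x` by the multiset `X = {a_1, …, a_N}`, which is
given as a family indexed by `Fin N`. -/
def representations {s N : ℕ} (X : Fin N → Fin s → ℤ) (x : Fin s → ℤ) : Set (Fin N → ℕ) :=
  {β | ∑ i, β i • X i = x}

/-- The discrete truncated power (partition function) `t_X`. -/
noncomputable def partitionFunction {s N : ℕ} (X : Fin N → Fin s → ℤ) (x : Fin s → ℤ) : ℕ :=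
  (representations X x).ncard

/-- The lattice cone `Λ_A^+(c)` with apex `c`; `Λ_A^+` is the case `c = 0`. -/
def latticeCone {s n : ℕ} (A : Fin n → Fin s → ℤ) (c : Fin s → ℤ) : Set (Fin s → ℤ) :=
  {x | ∃ α : Fin n → ℕ, x = c + ∑ i, α i • A i}

/-- The real cone `c + C(A)`. -/
def realCone {s n : ℕ} (A : Fin n → Fin s → ℤ) (c : Fin s → ℤ) : Set (Fin s → ℝ) :=
  {x | ∃ α : Fin n → ℝ, (∀ i, 0 ≤ α i) ∧ x = toReal c + ∑ i, α i • toReal (A i)}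

/-- The nonnegative integral multiples of the vectors of `X`. -/
def multiples {s N : ℕ} (X : Fin N → Fin s → ℤ) : Set (Fin s → ℤ) :=
  {v | ∃ (i : Fin N) (n : ℕ), v = n • X i}

/-- `f : ℤ^s → ℝ` is a periodic piecewise polynomial of degree at most `D` with respect to the
finite family of regions `K`: for a common period `d ≥ 1`, on the integral points of every cell cut
out by the family (the points that lie in `K j` exactly for the indices `j ∈ S`), `f` is given by
polynomials of degree at most `D` which depend only on the residue of the point modulo `d`. -/
def IsPeriodicPiecewisePolynomial {s m : ℕ} (K : Fin m → Set (Fin s → ℝ)) (D : ℕ)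
    (f : (Fin s → ℤ) → ℝ) : Prop :=
  ∃ d : ℕ, 0 < d ∧ ∀ S : Set (Fin m), ∃ P : (Fin s → ZMod d) → MvPolynomial (Fin s) ℝ,
    (∀ r, (P r).totalDegree ≤ D) ∧
    ∀ x : Fin s → ℤ, {j | toReal x ∈ K j} = S →
      f x = MvPolynomial.eval (toReal x) (P (fun k => (x k : ZMod d)))

end DiscreteTruncatedPower

/-!
If `v` is adjoined to a family `Y`, then `t_Y = (1 - τ_v) t_{v,Y}`, where `τ_v` is translation by
`v`; likewise the family obtained from `Y` by exchanging a factor `Y_k` for `v` has truncated power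
`(1 - τ_{Y_k}) t_{v,Y}`. Let `G` be a group of functions stable under translation by `Λ_X^+`. The
`v ∈ Λ_X^+` with `(1 - τ_v) t ∈ G` are closed under sums, and under differences that lie in
`Λ_X^+`. Hence `t_Y ∈ G` as soon as `v` lies in the group generated by those `Y_k` whose exchange
for `v` gives a truncated power in `G`: a discrete form of partial fractions. If the distinct
vectors of `Y` are dependent, an integral relation can be normalised, after passing to multiples,
so that one vector is an integral combination of others; exchanges then eliminate one of the
distinct vectors, and in the end only the vectors of a basis remain, with repetitions.

For a basis `A` with repetitions the coordinates of a lattice point are unique, and the number of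
representations is a product of multiset coefficients, which are Hilbert polynomials in the
coordinates, of total degree `N - s`. Finally, the lattice spanned by `A` contains `d ℤ^s` for every
multiple `d` of `det A`, so on the real cone `c + C(A)` membership in `Λ_A^+(c)` is decided by the
residue modulo `d`.
-/

namespace DiscreteTruncatedPower

open scoped translate
open Matrix (vecCons)

section Exchange

variable {M R : Type*} [AddCommGroup M]

lemma exists_add_eq_of_mem_addSubgroup_closure {S : Set M} {v : M}
    (hv : v ∈ AddSubgroup.closure S) :
    ∃ u ∈ AddSubmonoid.closure S, ∃ w ∈ AddSubmonoid.closure S, v + u = w := by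
  induction hv using AddSubgroup.closure_induction with
  | mem v hv => exact ⟨0, zero_mem _, v, AddSubmonoid.subset_closure hv, add_zero v⟩
  | zero => exact ⟨0, zero_mem _, 0, zero_mem _, add_zero 0⟩
  | add v v' _ _ h h' =>
    obtain ⟨u, hu, w, hw, rfl⟩ := h
    obtain ⟨u', hu', w', hw', rfl⟩ := h'
    exact ⟨u + u', add_mem hu hu', _, add_mem hw hw', add_add_add_comm ..⟩
  | neg v _ h =>
    obtain ⟨u, hu, w, hw, rfl⟩ := h
    exact ⟨v + u, hw, u, hu, neg_add_cancel_left v u⟩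

variable [AddCommGroup R] {Λ : AddSubmonoid M} {G : AddSubgroup (M → R)}

/-- The translations `v ∈ Λ` under which `g` is invariant modulo `G`. -/
def periodsModulo (hG : ∀ v ∈ Λ, ∀ f ∈ G, τ v f ∈ G) (g : M → R) : AddSubmonoid M where
  carrier := {v | v ∈ Λ ∧ g - τ v g ∈ G}
  zero_mem' := ⟨zero_mem Λ, by simp⟩
  add_mem' := by
    rintro u v ⟨hu, hgu⟩ ⟨hv, hgv⟩
    refine ⟨add_mem hu hv, ?_⟩
    have h := add_mem hgu (hG u hu _ hgv)
    rwa [translate_sub_right, ← translate_add, sub_add_sub_cancel] at h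

lemma sub_translate_mem_of_mem_closure (hG : ∀ v ∈ Λ, ∀ f ∈ G, τ v f ∈ G) {g : M → R}
    {S : Set M} (hS : S ⊆ Λ) (hgS : ∀ v ∈ S, g - τ v g ∈ G) {v : M} (hvΛ : v ∈ Λ)
    (hv : v ∈ AddSubgroup.closure S) : g - τ v g ∈ G := by
  have hperiod : AddSubmonoid.closure S ≤ periodsModulo hG g :=
    AddSubmonoid.closure_le.2 fun v hv => ⟨hS hv, hgS v hv⟩
  obtain ⟨u, hu, w, hw, hvu⟩ := exists_add_eq_of_mem_addSubgroup_closure hv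
  have h := sub_mem (hperiod hw).2 (hG v hvΛ _ (hperiod hu).2)
  rwa [← hvu, translate_sub_right, ← translate_add, sub_sub_sub_cancel_right] at h

end Exchange

section Lattice

variable {s N n : ℕ}

lemma toReal_sum_zsmul {ι : Type*} [Fintype ι] (A : ι → Fin s → ℤ) (z : ι → ℤ) :
    toReal (∑ i, z i • A i) = ∑ i, (z i : ℝ) • toReal (A i) := by
  ext k
  simp [toReal, Finset.sum_apply]

lemma toReal_add (v w : Fin s → ℤ) : toReal (v + w) = toReal v + toReal w := by
  ext k
  simp [toReal]

lemma toReal_nsmul (q : ℕ) (v : Fin s → ℤ) : toReal (q • v) = (q : ℝ) • toReal v := by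
  ext k
  simp [toReal]

lemma toReal_add_sum_nsmul {ι : Type*} [Fintype ι] (A : ι → Fin s → ℤ) (c : Fin s → ℤ)
    (α : ι → ℕ) :
    toReal (c + ∑ i, α i • A i) = toReal c + ∑ i, (α i : ℝ) • toReal (A i) := by
  ext k
  simp [toReal, Finset.sum_apply]

lemma sum_smul_comp {ι κ M : Type*} [Fintype ι] [Fintype κ] [DecidableEq κ] [AddCommMonoid M]
    (A : κ → M) (π : ι → κ) (β : ι → ℕ) :
    ∑ k, β k • (A ∘ π) k = ∑ i, (∑ k : {k // π k = i}, β k) • A i := by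
  rw [← Fintype.sum_fiberwise π]
  refine Finset.sum_congr rfl fun i _ => ?_
  rw [Finset.sum_smul]
  exact Finset.sum_congr rfl fun k _ => by rw [Function.comp_apply, k.2]

lemma mem_latticeCone_iff_sub_mem {A : Fin n → Fin s → ℤ} {c x : Fin s → ℤ} :
    x ∈ latticeCone A c ↔ x - c ∈ AddSubmonoid.closure (Set.range A) := by
  simp only [latticeCone, Set.mem_ofPred_eq, AddSubmonoid.mem_closure_range_iff_of_fintype,
    sub_eq_iff_eq_add']

lemma coe_closure_range (X : Fin N → Fin s → ℤ) :
    (AddSubmonoid.closure (Set.range X) : Set (Fin s → ℤ)) = latticeCone X 0 := by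
  ext x
  rw [mem_latticeCone_iff_sub_mem, sub_zero, SetLike.mem_coe]

lemma multiples_subset_closure (X : Fin N → Fin s → ℤ) :
    multiples X ⊆ AddSubmonoid.closure (Set.range X) := by
  rintro _ ⟨i, n, rfl⟩
  exact nsmul_mem (AddSubmonoid.subset_closure (Set.mem_range_self i)) n

lemma mem_multiples_self (X : Fin N → Fin s → ℤ) (i : Fin N) : X i ∈ multiples X :=
  ⟨i, 1, (one_nsmul _).symm⟩

lemma nsmul_mem_multiples {X : Fin N → Fin s → ℤ} {v : Fin s → ℤ} (hv : v ∈ multiples X) (q : ℕ) :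
    q • v ∈ multiples X := by
  obtain ⟨i, n, rfl⟩ := hv
  exact ⟨i, q * n, (mul_nsmul' ..).symm⟩

lemma latticeCone_subset {X : Fin N → Fin s → ℤ} {A : Fin n → Fin s → ℤ} {c : Fin s → ℤ}
    (hA : ∀ i, A i ∈ multiples X) (hc : c ∈ latticeCone X 0) :
    latticeCone A c ⊆ latticeCone X 0 := by
  intro x hx
  rw [← coe_closure_range] at hc ⊢
  have hle : AddSubmonoid.closure (Set.range A) ≤ AddSubmonoid.closure (Set.range X) :=
    AddSubmonoid.closure_le.2 (Set.range_subset_iff.2 fun i => multiples_subset_closure X (hA i))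
  have h := add_mem hc (hle (mem_latticeCone_iff_sub_mem.1 hx))
  rwa [add_sub_cancel] at h

end Lattice

section Pointed

variable {s N n : ℕ}

/-- A family of lattice vectors is pointed if it has no nontrivial relation with nonnegative
integral coefficients. -/
def IsPointed (Y : Fin N → Fin s → ℤ) : Prop :=
  ∀ β : Fin N → ℕ, ∑ i, β i • Y i = 0 → β = 0

lemma isPointed_of_forall_real {X : Fin N → Fin s → ℤ}
    (hX : ∀ u : Fin N → ℝ, (∀ i, 0 ≤ u i) → ∑ i, u i • toReal (X i) = 0 → u = 0) :
    IsPointed X := by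
  intro β hβ
  have hu := hX (fun i => β i) (fun i => Nat.cast_nonneg _) <| by
    have h0 : toReal (0 : Fin s → ℤ) = 0 := funext fun _ => Int.cast_zero
    have h := toReal_add_sum_nsmul X 0 β
    rwa [hβ, add_zero, h0, zero_add, eq_comm] at h
  exact funext fun i => Nat.cast_eq_zero.1 (congrFun hu i)

lemma IsPointed.ne_zero {X : Fin N → Fin s → ℤ} (hX : IsPointed X) (i : Fin N) : X i ≠ 0 := by
  intro hi
  have h := hX (Pi.single i 1) (by simp [Pi.single_apply, hi])
  simpa using congrFun h i

lemma IsPointed.of_mem_multiples {X : Fin N → Fin s → ℤ} {Y : Fin n → Fin s → ℤ}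
    (hX : IsPointed X) (hY : ∀ k, Y k ∈ multiples X \ {0}) : IsPointed Y := by
  intro β hβ
  choose l q hq using fun k => (hY k).1
  have hsum : ∑ i, (∑ k : {k // l k = i}, β k * q k) • X i = 0 := by
    rw [← sum_smul_comp X l fun k => β k * q k, ← hβ]
    exact Finset.sum_congr rfl fun k _ => by rw [hq k, mul_smul, Function.comp_apply]
  ext k
  have hβq : β k * q k = 0 :=
    Finset.sum_eq_zero_iff.1 (congrFun (hX _ hsum) (l k)) ⟨k, rfl⟩ (Finset.mem_univ _)
  refine (mul_eq_zero.1 hβq).resolve_right fun hq0 => (hY k).2 ?_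
  simp [hq k, hq0]

lemma IsPointed.comp {Y : Fin N → Fin s → ℤ} (hY : IsPointed Y) (f : Fin n → Fin N) :
    IsPointed (Y ∘ f) :=
  hY.of_mem_multiples fun k => ⟨mem_multiples_self Y (f k), hY.ne_zero (f k)⟩

lemma IsPointed.finite_representations {Y : Fin N → Fin s → ℤ} (hY : IsPointed Y)
    (x : Fin s → ℤ) : (representations Y x).Finite := by
  have hanti : IsAntichain (· ≤ ·) (representations Y x) := by
    intro β hβ γ hγ hne hle
    obtain ⟨δ, rfl⟩ := exists_add_of_le hle
    have hδ : ∑ i, δ i • Y i = 0 := by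
      have h : ∑ i, (β + δ) i • Y i = ∑ i, β i • Y i := hγ.trans hβ.symm
      simpa [add_smul, Finset.sum_add_distrib] using h
    exact hne (by rw [hY δ hδ, add_zero])
  exact hanti.finite_of_partiallyWellOrderedOn (Set.isPWO_of_wellQuasiOrderedLE _)

end Pointed

section TruncatedPower

variable {s N : ℕ}

/-- The discrete truncated power `t_Y` as a real-valued function on the lattice, so that
translates and differences of truncated powers make sense. -/
noncomputable def truncatedPower (Y : Fin N → Fin s → ℤ) : (Fin s → ℤ) → ℝ :=
  fun x => partitionFunction Y x

lemma truncatedPower_comp_perm (Y : Fin N → Fin s → ℤ) (e : Equiv.Perm (Fin N)) :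
    truncatedPower (Y ∘ e) = truncatedPower Y := by
  ext x
  refine congrArg Nat.cast (Nat.card_congr <|
    (Equiv.arrowCongr e (Equiv.refl ℕ)).subtypeEquiv fun β => ?_)
  have h : ∑ i, β i • (Y ∘ e) i = ∑ i, β (e.symm i) • Y i := by
    rw [← Equiv.sum_comp e fun i => β (e.symm i) • Y i]
    simp only [Equiv.symm_apply_apply, Function.comp_apply]
  exact Eq.congr_left h

lemma cons_mem_representations {Y : Fin N → Fin s → ℤ} {v x : Fin s → ℤ} {b : ℕ}
    {β : Fin N → ℕ} :
    Fin.cons b β ∈ representations (vecCons v Y) x ↔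
      b • v + ∑ i, β i • Y i = x := by
  simp [representations, Fin.sum_univ_succ]

lemma representations_cons (Y : Fin N → Fin s → ℤ) (v x : Fin s → ℤ) :
    representations (vecCons v Y) x =
      Fin.cons 0 '' representations Y x ∪
        (Pi.single 0 1 + ·) '' representations (vecCons v Y) (x - v) := by
  have hsucc (b : ℕ) (β : Fin N → ℕ) :
      Pi.single 0 1 + (Fin.cons b β : Fin (N + 1) → ℕ) = Fin.cons (b + 1) β := by
    ext k
    cases k using Fin.cases <;> simp [add_comm]
  ext β
  constructor
  · induction β using Fin.consCases with | _ b β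
    rw [cons_mem_representations]
    intro hβ
    cases b with
    | zero => exact .inl ⟨β, by rwa [zero_nsmul, zero_add] at hβ, rfl⟩
    | succ b =>
      refine .inr ⟨Fin.cons b β, cons_mem_representations.2 ?_, hsucc b β⟩
      rw [← hβ, succ_nsmul]
      abel
  · rintro (⟨β, hβ, rfl⟩ | ⟨γ, hγ, rfl⟩)
    · rw [cons_mem_representations, zero_nsmul, zero_add]
      exact hβ
    · induction γ using Fin.consCases with | _ b β
      simp only [hsucc, cons_mem_representations] at hγ ⊢
      rw [← sub_add_cancel x v, ← hγ, succ_nsmul]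
      abel

lemma truncatedPower_cons_sub_translate {Y : Fin N → Fin s → ℤ} {v : Fin s → ℤ}
    (hY : IsPointed (vecCons v Y)) :
    truncatedPower (vecCons v Y) - τ v (truncatedPower (vecCons v Y)) = truncatedPower Y := by
  ext x
  have hcons : (Fin.cons 0 '' representations Y x :
      Set (Fin (N + 1) → ℕ)).ncard = partitionFunction Y x :=
    Set.ncard_image_of_injective _ (Fin.cons_right_injective 0)
  have hshift := Set.ncard_image_of_injective
    (representations (vecCons v Y) (x - v)) (add_right_injective (Pi.single 0 1))
  have hdisj : Disjoint (Fin.cons 0 '' representations Y x : Set (Fin (N + 1) → ℕ))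
      ((Pi.single 0 1 + ·) '' representations (vecCons v Y) (x - v)) := by
    rw [Set.disjoint_left]
    rintro _ ⟨β, -, rfl⟩ ⟨γ, -, hγ⟩
    simpa using congrFun hγ 0
  have hfin := hY.finite_representations x
  rw [representations_cons, Set.finite_union] at hfin
  have h := Set.ncard_union_eq hdisj hfin.1 hfin.2
  rw [← representations_cons, hcons, hshift] at h
  simp only [Pi.sub_apply, translate_apply, truncatedPower, partitionFunction] at h ⊢
  rw [h, Nat.cast_add, add_sub_cancel_right]

lemma truncatedPower_update {Y : Fin N → Fin s → ℤ} {v : Fin s → ℤ}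
    (hY : IsPointed (vecCons v Y)) (k : Fin N) :
    truncatedPower (Function.update Y k v) =
      truncatedPower (vecCons v Y) - τ (Y k) (truncatedPower (vecCons v Y)) := by
  have hswap : vecCons (Y k) (Function.update Y k v) = vecCons v Y ∘ Equiv.swap 0 k.succ := by
    ext j : 1
    cases j using Fin.cases with
    | zero => simp
    | succ j =>
      rcases eq_or_ne j k with rfl | hj
      · simp
      · simp [hj, Equiv.swap_apply_of_ne_of_ne]
  have hY' : IsPointed (vecCons (Y k) (Function.update Y k v)) := hswap ▸ hY.comp _
  rw [← truncatedPower_cons_sub_translate hY', hswap, truncatedPower_comp_perm]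

end TruncatedPower

lemma range_update_eq_compl {ι κ : Type*} [DecidableEq ι] {ρ : ι → κ} (hρ : ρ.Surjective)
    {k : ι} {i : κ} (h : ¬ (Function.update ρ k i).Surjective) :
    Set.range (Function.update ρ k i) = {ρ k}ᶜ := by
  have hmem : ∀ j ≠ ρ k, j ∈ Set.range (Function.update ρ k i) := by
    intro j hj
    obtain ⟨l, rfl⟩ := hρ j
    exact ⟨l, Function.update_of_ne (by rintro rfl; exact hj rfl) _ _⟩
  refine Set.Subset.antisymm ?_ hmem
  rw [Set.subset_compl_singleton_iff]
  intro hk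
  refine h fun j => ?_
  rcases eq_or_ne j (ρ k) with rfl | hj
  exacts [hk, hmem j hj]

section Reduction

variable {s N n : ℕ} {X : Fin N → Fin s → ℤ} {G : AddSubgroup ((Fin s → ℤ) → ℝ)}
  (hX : IsPointed X) (hG : ∀ v ∈ AddSubmonoid.closure (Set.range X), ∀ f ∈ G, τ v f ∈ G)

include hX hG

lemma truncatedPower_mem_of_update_mem {Y : Fin n → Fin s → ℤ} {v : Fin s → ℤ}
    (hY : ∀ k, Y k ∈ multiples X \ {0}) (hv : v ∈ multiples X \ {0}) {K : Set (Fin n)}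
    (hvK : v ∈ AddSubgroup.closure (Y '' K))
    (hK : ∀ k ∈ K, truncatedPower (Function.update Y k v) ∈ G) : truncatedPower Y ∈ G := by
  have hpointed : IsPointed (vecCons v Y) := hX.of_mem_multiples (Fin.cases hv hY)
  rw [← truncatedPower_cons_sub_translate hpointed]
  refine sub_translate_mem_of_mem_closure hG ?_ ?_ (multiples_subset_closure X hv.1) hvK
  · rintro _ ⟨k, -, rfl⟩
    exact multiples_subset_closure X (hY k).1
  · rintro _ ⟨k, hk, rfl⟩
    rw [← truncatedPower_update hpointed]
    exact hK k hk

lemma truncatedPower_mem_of_nsmul_mem {Y : Fin n → Fin s → ℤ}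
    (hY : ∀ k, Y k ∈ multiples X \ {0}) {q : Fin n → ℕ}
    (hqY : ∀ k, q k • Y k ∈ multiples X \ {0})
    (h : truncatedPower (fun k => q k • Y k) ∈ G) : truncatedPower Y ∈ G := by
  classical
  suffices ∀ T : Finset (Fin n), truncatedPower (T.piecewise Y fun k => q k • Y k) ∈ G by
    simpa using this Finset.univ
  intro T
  induction T using Finset.induction with
  | empty => simpa using h
  | insert k T hk ih =>
    refine truncatedPower_mem_of_update_mem hX hG (K := {k}) (v := q k • Y k) ?_ (hqY k) ?_ ?_
    · intro j
      simp only [Finset.piecewise]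
      split_ifs
      exacts [hY j, hqY j]
    · exact nsmul_mem (AddSubgroup.subset_closure (by simp)) _
    · rintro _ rfl
      have hk' := T.piecewise_eq_of_notMem Y (fun k => q k • Y k) hk
      rwa [Finset.piecewise_insert, Function.update_idem, ← hk', Function.update_eq_self]

lemma truncatedPower_comp_mem_of_mem_closure {b : Fin n → Fin s → ℤ}
    (hb : ∀ i, b i ∈ multiples X \ {0}) {i₀ : Fin n} {C : Set (Fin n)} (hi₀ : i₀ ∉ C)
    (hbC : b i₀ ∈ AddSubgroup.closure (b '' C))
    (hC : ∀ i ∈ C, ∀ ρ : Fin N → Fin n, Set.range ρ = {i}ᶜ → truncatedPower (b ∘ ρ) ∈ G)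
    {ρ : Fin N → Fin n} (hρ : ρ.Surjective) : truncatedPower (b ∘ ρ) ∈ G := by
  induction hm : Finset.card {k | ρ k ≠ i₀} using Nat.strong_induction_on generalizing ρ with
  | _ m ih
  subst hm
  refine truncatedPower_mem_of_update_mem hX hG (fun k => hb (ρ k)) (hb i₀) (K := ρ ⁻¹' C) ?_ ?_
  · rwa [Set.image_comp, Set.image_preimage_eq C hρ]
  intro k hk
  have hρk : ρ k ≠ i₀ := fun h => hi₀ (h ▸ hk)
  rw [← Function.comp_update]
  by_cases hsurj : (Function.update ρ k i₀).Surjective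
  · refine ih _ (Finset.card_lt_card ?_) hsurj rfl
    rw [Finset.ssubset_iff_of_subset]
    · exact ⟨k, by simpa using hρk, by simp⟩
    · intro j
      rcases eq_or_ne j k with rfl | hj <;> simp +contextual [*]
  · exact hC (ρ k) hk _ (range_update_eq_compl hρ hsurj)

end Reduction

lemma exists_normalized_relation {M ι : Type*} [AddCommGroup M] [Fintype ι] {b : ι → M}
    (hb : ¬ LinearIndependent ℤ b) :
    ∃ (i₀ : ι) (q : ι → ℕ) (c : ι → ℤ),
      (∀ i, q i ≠ 0) ∧ c i₀ = 1 ∧ ∑ i, c i • q i • b i = 0 := by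
  classical
  obtain ⟨z, hz, i₀, hi₀⟩ := Fintype.not_linearIndependent_iff.1 hb
  refine ⟨i₀, Function.update (1 : ι → ℕ) i₀ (z i₀).natAbs,
    Function.update (fun i => (z i₀).sign * z i) i₀ 1, fun i => ?_, by simp, ?_⟩
  · rcases eq_or_ne i i₀ with rfl | hi <;> simp [*]
  · have hterm : ∀ i, Function.update (fun i => (z i₀).sign * z i) i₀ 1 i •
        Function.update (1 : ι → ℕ) i₀ (z i₀).natAbs i • b i = (z i₀).sign • z i • b i := by
      intro i
      rcases eq_or_ne i i₀ with rfl | hi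
      · simp [← natCast_zsmul, smul_smul]
      · simp [hi, mul_smul]
    rw [Finset.sum_congr rfl fun i _ => hterm i, ← Finset.smul_sum, hz, smul_zero]

lemma mem_closure_of_relation {M ι : Type*} [AddCommGroup M] [Fintype ι] {v : ι → M} {c : ι → ℤ}
    {i₀ : ι} (hi₀ : c i₀ = 1) (h : ∑ i, c i • v i = 0) :
    v i₀ ∈ AddSubgroup.closure (v '' {i | i ≠ i₀ ∧ c i ≠ 0}) := by
  classical
  rw [← Finset.add_sum_erase _ _ (Finset.mem_univ i₀), hi₀, one_zsmul] at h
  rw [eq_neg_of_add_eq_zero_left h]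
  refine neg_mem (sum_mem fun i hi => ?_)
  by_cases hci : c i = 0
  · simp [hci]
  · refine zsmul_mem (AddSubgroup.subset_closure ?_) _
    exact ⟨i, ⟨Finset.ne_of_mem_erase hi, hci⟩, rfl⟩

lemma span_range_comp_succAbove {K V : Type*} [Field K] [AddCommGroup V] [Module K V] {n : ℕ}
    {v : Fin (n + 1) → V} {c : Fin (n + 1) → K} (h : ∑ i, c i • v i = 0) {i : Fin (n + 1)}
    (hi : c i ≠ 0) :
    Submodule.span K (Set.range (v ∘ i.succAbove)) = Submodule.span K (Set.range v) := by
  have hvi : v i ∈ Submodule.span K (Set.range (v ∘ i.succAbove)) := by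
    rw [Fin.sum_univ_succAbove _ i] at h
    rw [← Submodule.smul_mem_iff _ hi, eq_neg_of_add_eq_zero_left h]
    exact neg_mem (sum_mem fun j _ =>
      Submodule.smul_mem _ _ (Submodule.subset_span (Set.mem_range_self j)))
  refine le_antisymm (Submodule.span_mono (Set.range_comp_subset_range _ _)) ?_
  rw [Submodule.span_le, Set.range_subset_iff]
  intro j
  rcases eq_or_ne j i with rfl | hj
  · exact hvi
  · obtain ⟨l, rfl⟩ := Fin.exists_succAbove_eq hj
    exact Submodule.subset_span (Set.mem_range_self l)

lemma span_range_smul_eq {K V ι : Type*} [Field K] [AddCommGroup V] [Module K V]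
    {c : ι → K} (hc : ∀ i, c i ≠ 0) (v : ι → V) :
    Submodule.span K (Set.range fun i => c i • v i) = Submodule.span K (Set.range v) := by
  refine le_antisymm ?_ ?_ <;> rw [Submodule.span_le, Set.range_subset_iff] <;> intro i
  · exact Submodule.smul_mem _ _ (Submodule.subset_span (Set.mem_range_self i))
  · exact (Submodule.smul_mem_iff _ (hc i)).1 (Submodule.subset_span (Set.mem_range_self i))

section Decomposition

variable {s N n : ℕ} {X : Fin N → Fin s → ℤ} {G : AddSubgroup ((Fin s → ℤ) → ℝ)}

lemma eq_and_linearIndependent_toReal_of_span_eq_top {b : Fin n → Fin s → ℤ}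
    (hb : LinearIndependent ℤ b)
    (hspan : Submodule.span ℝ (Set.range fun i => toReal (b i)) = ⊤) :
    n = s ∧ LinearIndependent ℝ fun i => toReal (b i) := by
  have hle : n ≤ s := by simpa using hb.fintype_card_le_finrank
  have hge : s ≤ n := by
    have h := finrank_range_le_card (R := ℝ) fun i => toReal (b i)
    rw [Set.finrank, hspan] at h
    simpa using h
  obtain rfl := le_antisymm hle hge
  exact ⟨rfl, linearIndependent_of_top_le_span_of_card_eq_finrank hspan.ge (by simp)⟩

lemma exists_eq_succAbove_comp {ρ : Fin N → Fin (n + 1)} {i : Fin (n + 1)}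
    (hρ : Set.range ρ = {i}ᶜ) : ∃ σ : Fin N → Fin n, σ.Surjective ∧ ρ = i.succAbove ∘ σ := by
  rw [← Fin.range_succAbove] at hρ
  obtain ⟨σ, rfl⟩ := Set.range_subset_range_iff_exists_comp.1 hρ.le
  refine ⟨σ, fun j => ?_, rfl⟩
  obtain ⟨k, hk⟩ := hρ.ge (Set.mem_range_self j)
  exact ⟨k, Fin.succAbove_right_injective hk⟩

lemma truncatedPower_comp_mem (hX : IsPointed X)
    (hG : ∀ v ∈ AddSubmonoid.closure (Set.range X), ∀ f ∈ G, τ v f ∈ G)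
    (hbasic : ∀ (A : Fin s → Fin s → ℤ) (π : Fin N → Fin s),
      LinearIndependent ℝ (fun i => toReal (A i)) → (∀ i, A i ∈ multiples X) → π.Surjective →
      truncatedPower (A ∘ π) ∈ G)
    {b : Fin n → Fin s → ℤ} (hb : ∀ i, b i ∈ multiples X \ {0})
    (hspan : Submodule.span ℝ (Set.range fun i => toReal (b i)) = ⊤)
    {ρ : Fin N → Fin n} (hρ : ρ.Surjective) : truncatedPower (b ∘ ρ) ∈ G := by
  induction n with
  | zero =>
    obtain ⟨rfl, h⟩ :=
      eq_and_linearIndependent_toReal_of_span_eq_top (linearIndependent_empty_type ..) hspan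
    exact hbasic b ρ h (fun i => (hb i).1) hρ
  | succ n ih =>
    by_cases hind : LinearIndependent ℤ b
    · obtain ⟨rfl, h⟩ := eq_and_linearIndependent_toReal_of_span_eq_top hind hspan
      exact hbasic b ρ h (fun i => (hb i).1) hρ
    obtain ⟨i₀, q, c, hq, hi₀, hrel⟩ := exists_normalized_relation hind
    have hqb : ∀ i, q i • b i ∈ multiples X \ {0} := fun i =>
      ⟨nsmul_mem_multiples (hb i).1 _, smul_ne_zero (hq i) (hb i).2⟩
    have hqspan : Submodule.span ℝ (Set.range fun i => toReal (q i • b i)) = ⊤ := by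
      simp only [toReal_nsmul]
      exact (span_range_smul_eq (fun i => Nat.cast_ne_zero.2 (hq i)) _).trans hspan
    have hrel' : ∑ i, (c i : ℝ) • toReal (q i • b i) = 0 := by
      rw [← toReal_sum_zsmul, hrel]
      exact funext fun _ => Int.cast_zero
    refine truncatedPower_mem_of_nsmul_mem hX hG (fun k => hb (ρ k)) (q := q ∘ ρ)
      (fun k => hqb (ρ k)) ?_
    refine truncatedPower_comp_mem_of_mem_closure hX hG hqb (i₀ := i₀)
      (fun h => h.1 rfl) (mem_closure_of_relation hi₀ hrel) ?_ hρ
    intro i hi ρ' hρ'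
    obtain ⟨σ, hσ, rfl⟩ := exists_eq_succAbove_comp hρ'
    refine ih (fun j => hqb (i.succAbove j)) ?_ hσ
    exact (span_range_comp_succAbove hrel' (Int.cast_ne_zero.2 hi.2)).trans hqspan

/-- The translates `τ c t_{A ∘ π}` of truncated powers whose factors, possibly repeated, are the
members of a basis `A` of `ℝ^s`; `π` records which factors coincide. -/
def basicTruncatedPowers (X : Fin N → Fin s → ℤ) : Set ((Fin s → ℤ) → ℝ) :=
  {f | ∃ (A : Fin s → Fin s → ℤ) (π : Fin N → Fin s) (c : Fin s → ℤ),
    LinearIndependent ℝ (fun i => toReal (A i)) ∧ (∀ i, A i ∈ multiples X) ∧ π.Surjective ∧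
    c ∈ latticeCone X 0 ∧ f = τ c (truncatedPower (A ∘ π))}

lemma translate_mem_closure_basicTruncatedPowers {v : Fin s → ℤ}
    (hv : v ∈ AddSubmonoid.closure (Set.range X)) {f : (Fin s → ℤ) → ℝ}
    (hf : f ∈ AddSubgroup.closure (basicTruncatedPowers X)) :
    τ v f ∈ AddSubgroup.closure (basicTruncatedPowers X) := by
  induction hf using AddSubgroup.closure_induction with
  | mem f hf =>
    obtain ⟨A, π, c, hA, hAX, hπ, hc, rfl⟩ := hf
    refine AddSubgroup.subset_closure ⟨A, π, v + c, hA, hAX, hπ, ?_, (translate_add ..).symm⟩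
    rw [← coe_closure_range] at hc ⊢
    exact add_mem hv hc
  | zero => exact zero_mem _
  | add f g _ _ hf hg => exact add_mem hf hg
  | neg f _ hf => exact neg_mem hf

lemma truncatedPower_mem_closure_basicTruncatedPowers (hX : IsPointed X)
    (hspan : Submodule.span ℝ (Set.range fun i => toReal (X i)) = ⊤) :
    truncatedPower X ∈ AddSubgroup.closure (basicTruncatedPowers X) := by
  refine truncatedPower_comp_mem hX (fun v hv f => translate_mem_closure_basicTruncatedPowers hv)
    (fun A π hA hAX hπ => AddSubgroup.subset_closure ⟨A, π, 0, hA, hAX, hπ, ?_, ?_⟩)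
    (fun i => ⟨mem_multiples_self X i, hX.ne_zero i⟩) hspan Function.surjective_id
  · rw [← coe_closure_range]
    exact zero_mem _
  · rw [translate_zero]

end Decomposition

section Basis

variable {s N n : ℕ}

lemma natCard_sum_eq {ι : Type*} [Fintype ι] (a : ℕ) :
    Nat.card {P : ι → ℕ // ∑ i, P i = a} = (Fintype.card ι).multichoose a := by
  classical
  rw [← Nat.card_congr (Sym.equivNatSumOfFintype ι a), Nat.card_eq_fintype_card,
    Sym.card_sym_eq_multichoose]

lemma partitionFunction_comp {A : Fin n → Fin s → ℤ}
    (hA : Function.Injective fun α : Fin n → ℕ => ∑ i, α i • A i) (π : Fin N → Fin n)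
    (α : Fin n → ℕ) :
    partitionFunction (A ∘ π) (∑ i, α i • A i) =
      ∏ i, (Fintype.card {k // π k = i}).multichoose (α i) := by
  let fibers : (Fin N → ℕ) ≃ ((i : Fin n) → {k // π k = i} → ℕ) :=
    ((Equiv.sigmaFiberEquiv π).symm.arrowCongr (Equiv.refl ℕ)).trans (Equiv.piCurry fun _ _ => ℕ)
  have hmem : ∀ β, β ∈ representations (A ∘ π) (∑ i, α i • A i) ↔
      ∀ i, ∑ k, fibers β i k = α i := by
    intro β
    rw [representations, Set.mem_ofPred_eq, sum_smul_comp]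
    exact hA.eq_iff.trans funext_iff
  calc partitionFunction (A ∘ π) (∑ i, α i • A i)
    _ = Nat.card ((i : Fin n) → {P : {k // π k = i} → ℕ // ∑ k, P k = α i}) :=
      Nat.card_congr ((fibers.subtypeEquiv hmem).trans Equiv.subtypePiEquivPi)
    _ = ∏ i, (Fintype.card {k // π k = i}).multichoose (α i) := by
      rw [Nat.card_pi]
      exact Finset.prod_congr rfl fun i _ => natCard_sum_eq (α i)

lemma partitionFunction_comp_eq_zero {A : Fin n → Fin s → ℤ} (π : Fin N → Fin n)
    {x : Fin s → ℤ} (hx : x ∉ latticeCone A 0) : partitionFunction (A ∘ π) x = 0 := by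
  have hempty : representations (A ∘ π) x = ∅ := by
    refine Set.eq_empty_of_forall_notMem fun β hβ => hx ⟨fun i => ∑ k : {k // π k = i}, β k, ?_⟩
    rw [zero_add, ← sum_smul_comp]
    exact hβ.symm
  rw [partitionFunction, hempty, Set.ncard_empty]

lemma injective_sum_nsmul {A : Fin n → Fin s → ℤ}
    (hA : LinearIndependent ℝ fun i => toReal (A i)) :
    Function.Injective fun α : Fin n → ℕ => ∑ i, α i • A i := by
  intro α β h
  have hreal := congrArg toReal (congrArg (0 + ·) h)
  simp only [toReal_add_sum_nsmul, add_right_inj] at hreal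
  exact funext fun i => Nat.cast_injective (Fintype.linearIndependent_iffₛ.1 hA _ _ hreal i)

end Basis

section Coordinates

lemma eval_preHilbertPoly_zero_eq_multichoose (F : Type*) [Field F] [CharZero F] (d a : ℕ) :
    (Polynomial.preHilbertPoly F d 0).eval (a : F) = (d + 1).multichoose a := by
  rw [Polynomial.preHilbertPoly_eq_choose_sub_add F d a.zero_le, Nat.multichoose_eq, Nat.sub_zero,
    add_right_comm, Nat.add_sub_cancel, add_comm d a, Nat.choose_symm_add]

lemma totalDegree_aeval_le {σ R : Type*} [CommSemiring R] (L : MvPolynomial σ R)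
    (q : Polynomial R) :
    (Polynomial.aeval L q).totalDegree ≤ q.natDegree * L.totalDegree := by
  rw [Polynomial.aeval_eq_sum_range]
  refine MvPolynomial.totalDegree_finsetSum_le fun k hk => ?_
  calc (q.coeff k • L ^ k).totalDegree
    _ ≤ (L ^ k).totalDegree := MvPolynomial.totalDegree_smul_le _ _
    _ ≤ k * L.totalDegree := MvPolynomial.totalDegree_pow _ _
    _ ≤ q.natDegree * L.totalDegree :=
      Nat.mul_le_mul_right _ (Finset.mem_range_succ_iff.1 hk)

variable {ι K : Type*} [Fintype ι] [Field K]

lemma exists_affine_coordinate_polynomial {v : ι → ι → K} (hv : LinearIndependent K v)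
    (c : ι → K) (i : ι) :
    ∃ L : MvPolynomial ι K, L.totalDegree ≤ 1 ∧
      ∀ α : ι → K, MvPolynomial.eval (c + ∑ j, α j • v j) L = α i := by
  classical
  let b := Module.Basis.mk hv (hv.span_eq_top_of_card_eq_finrank' (by simp)).ge
  let L : MvPolynomial ι K :=
    ∑ k, MvPolynomial.C (b.coord i (Pi.single k 1)) * MvPolynomial.X k -
      MvPolynomial.C (b.coord i c)
  have heval : ∀ y, MvPolynomial.eval y L = b.coord i (y - c) := by
    intro y
    rw [map_sub]
    conv_rhs => rw [pi_eq_sum_univ' y]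
    simp [mul_comm]
  refine ⟨L, ?_, fun α => ?_⟩
  · refine (MvPolynomial.totalDegree_sub _ _).trans (max_le ?_ (by simp))
    exact MvPolynomial.totalDegree_finsetSum_le fun k _ =>
      (MvPolynomial.totalDegree_mul _ _).trans (by simp)
  · have hb : ∑ j, α j • v j = ∑ j, α j • b j := by simp [b]
    rw [heval, add_sub_cancel_left, hb, Module.Basis.coord_apply, Module.Basis.repr_sum_self]

lemma exists_prod_coordinate_polynomial [Infinite K] {v : ι → ι → K} (hv : LinearIndependent K v)
    (c : ι → K) {q : ι → Polynomial K} (hq : ∀ i, q i ≠ 0) :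
    ∃ p : MvPolynomial ι K, p ≠ 0 ∧ p.totalDegree = ∑ i, (q i).natDegree ∧
      ∀ α : ι → K, MvPolynomial.eval (c + ∑ i, α i • v i) p = ∏ i, (q i).eval (α i) := by
  choose L hLdeg hL using exists_affine_coordinate_polynomial hv c
  let p := ∏ i, Polynomial.aeval (L i) (q i)
  have heval : ∀ α : ι → K,
      MvPolynomial.eval (c + ∑ i, α i • v i) p = ∏ i, (q i).eval (α i) := by
    intro α
    rw [map_prod]
    refine Finset.prod_congr rfl fun i _ => ?_
    rw [← MvPolynomial.coe_aeval_eq_eval, RingHom.coe_coe, ← Polynomial.aeval_algHom_apply,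
      MvPolynomial.aeval_eq_eval, hL, Polynomial.coe_aeval_eq_eval]
  -- Along this line through `c` all coordinates agree, so `p` restricts to `∏ i, q i`.
  let line : ι → Polynomial K := fun k =>
    Polynomial.C ((∑ i, v i) k) * Polynomial.X + Polynomial.C (c k)
  have hline : MvPolynomial.aeval line p = ∏ i, q i := by
    refine Polynomial.funext fun t => ?_
    have hpoint : (fun k => (line k).eval t) = c + ∑ i, t • v i := by
      ext k
      rw [← Finset.smul_sum]
      simp only [line, Polynomial.eval_add, Polynomial.eval_mul, Polynomial.eval_C,
        Polynomial.eval_X, Pi.add_apply, Pi.smul_apply, smul_eq_mul]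
      ring
    rw [← Polynomial.coe_aeval_eq_eval, MvPolynomial.comp_aeval_apply, Polynomial.coe_aeval_eq_eval,
      hpoint, MvPolynomial.aeval_eq_eval, heval fun _ => t, Polynomial.eval_prod]
  refine ⟨p, ?_, le_antisymm ?_ ?_, heval⟩
  · rintro hp
    rw [hp, map_zero] at hline
    exact Finset.prod_ne_zero_iff.2 (fun i _ => hq i) hline.symm
  · exact (MvPolynomial.totalDegree_finsetProd _ _).trans
      (Finset.sum_le_sum fun i _ => (totalDegree_aeval_le (L i) (q i)).trans <|
        (Nat.mul_le_mul_left _ (hLdeg i)).trans (mul_one _).le)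
  · rw [← Polynomial.natDegree_prod _ _ fun i _ => hq i, ← hline]
    refine (MvPolynomial.aeval_natDegree_le p le_rfl line fun k => ?_).trans (mul_one _).le
    exact Polynomial.natDegree_linear_le

end Coordinates

section Elementary

variable {s N : ℕ} {X : Fin N → Fin s → ℤ}

/-- The triples `(A, c, p)` allowed in the decomposition of `t_X`: a basis `A` of `ℝ^s` of multiples
of vectors of `X`, an apex `c ∈ Λ_X^+` and a nonzero polynomial `p` of total degree `N - s` (stated
without truncated subtraction). -/
structure IsElementary (X : Fin N → Fin s → ℤ) (A : Fin s → Fin s → ℤ) (c : Fin s → ℤ)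
    (p : MvPolynomial (Fin s) ℝ) : Prop where
  linearIndependent : LinearIndependent ℝ fun i => toReal (A i)
  mem_multiples : ∀ i, A i ∈ multiples X
  apex_mem : c ∈ latticeCone X 0
  ne_zero : p ≠ 0
  totalDegree_add : p.totalDegree + s = N

/-- The function on `ℤ^s` that is `p` on the lattice cone `Λ_A^+(c)` and zero elsewhere. -/
noncomputable def conePolynomial (A : Fin s → Fin s → ℤ) (c : Fin s → ℤ)
    (p : MvPolynomial (Fin s) ℝ) : (Fin s → ℤ) → ℝ :=
  (latticeCone A c).indicator fun y => MvPolynomial.eval (toReal y) p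

lemma IsElementary.neg {A : Fin s → Fin s → ℤ} {c : Fin s → ℤ} {p : MvPolynomial (Fin s) ℝ}
    (h : IsElementary X A c p) : IsElementary X A c (-p) :=
  { h with
    ne_zero := neg_ne_zero.2 h.ne_zero
    totalDegree_add := by rw [MvPolynomial.totalDegree_neg, h.totalDegree_add] }

lemma conePolynomial_neg (A : Fin s → Fin s → ℤ) (c : Fin s → ℤ) (p : MvPolynomial (Fin s) ℝ) :
    conePolynomial A c (-p) = -conePolynomial A c p := by
  simp only [conePolynomial, map_neg]
  exact Set.indicator_neg _ _

lemma card_fiber_sub_one_add_one {ι κ : Type*} [Fintype ι] [DecidableEq κ] {π : ι → κ}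
    (hπ : π.Surjective) (i : κ) :
    Fintype.card {k // π k = i} - 1 + 1 = Fintype.card {k // π k = i} := by
  obtain ⟨k, hk⟩ := hπ i
  exact Nat.sub_add_cancel (Fintype.card_pos_iff.2 ⟨k, hk⟩)

lemma sum_card_fiber_sub_one_add {ι κ : Type*} [Fintype ι] [Fintype κ] [DecidableEq κ]
    {π : ι → κ} (hπ : π.Surjective) :
    ∑ i, (Fintype.card {k // π k = i} - 1) + Fintype.card κ = Fintype.card ι :=
  calc ∑ i, (Fintype.card {k // π k = i} - 1) + Fintype.card κ
    _ = ∑ i, (Fintype.card {k // π k = i} - 1 + 1) := by simp [Finset.sum_add_distrib]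
    _ = ∑ i, Fintype.card {k // π k = i} :=
      Finset.sum_congr rfl fun i _ => card_fiber_sub_one_add_one hπ i
    _ = Fintype.card ι := by
      rw [← Fintype.card_sigma, Fintype.card_congr (Equiv.sigmaFiberEquiv π)]

lemma exists_eq_conePolynomial_of_mem_basicTruncatedPowers {f : (Fin s → ℤ) → ℝ}
    (hf : f ∈ basicTruncatedPowers X) :
    ∃ A c p, IsElementary X A c p ∧ f = conePolynomial A c p := by
  obtain ⟨A, π, c, hA, hAX, hπ, hc, rfl⟩ := hf
  have hne : ∀ d, Polynomial.preHilbertPoly ℝ d 0 ≠ 0 := fun d =>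
    Polynomial.leadingCoeff_ne_zero.1 <| by
      rw [Polynomial.leadingCoeff_preHilbertPoly]
      positivity
  obtain ⟨p, hp0, hpdeg, hp⟩ := exists_prod_coordinate_polynomial hA (toReal c)
    (q := fun i => Polynomial.preHilbertPoly ℝ (Fintype.card {k // π k = i} - 1) 0)
    fun _ => hne _
  refine ⟨A, c, p, ⟨hA, hAX, hc, hp0, ?_⟩, ?_⟩
  · simp only [hpdeg, Polynomial.natDegree_preHilbertPoly]
    simpa using sum_card_fiber_sub_one_add hπ
  ext x
  by_cases hx : x ∈ latticeCone A c
  · rw [conePolynomial, Set.indicator_of_mem hx]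
    obtain ⟨α, rfl⟩ := hx
    rw [translate_apply, add_sub_cancel_left, truncatedPower,
      partitionFunction_comp (injective_sum_nsmul hA), toReal_add_sum_nsmul, hp, Nat.cast_prod]
    refine Finset.prod_congr rfl fun i _ => ?_
    rw [eval_preHilbertPoly_zero_eq_multichoose, card_fiber_sub_one_add_one hπ]
  · rw [conePolynomial, Set.indicator_of_notMem hx, translate_apply, truncatedPower,
      partitionFunction_comp_eq_zero π, Nat.cast_zero]
    rwa [mem_latticeCone_iff_sub_mem, sub_zero, ← mem_latticeCone_iff_sub_mem]

lemma exists_eq_sum_conePolynomial {f : (Fin s → ℤ) → ℝ}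
    (hf : f ∈ AddSubgroup.closure (basicTruncatedPowers X)) :
    ∃ (m : ℕ) (A : Fin m → Fin s → Fin s → ℤ) (c : Fin m → Fin s → ℤ)
      (p : Fin m → MvPolynomial (Fin s) ℝ), (∀ j, IsElementary X (A j) (c j) (p j)) ∧
      f = ∑ j, conePolynomial (A j) (c j) (p j) := by
  rw [← AddSubgroup.mem_toAddSubmonoid, AddSubgroup.closure_toAddSubmonoid] at hf
  obtain ⟨l, hl, rfl⟩ := AddSubmonoid.exists_list_of_mem_closure hf
  have hterm : ∀ j : Fin l.length, ∃ A c p, IsElementary X A c p ∧ l[j] = conePolynomial A c p := by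
    intro j
    rcases hl _ (l.getElem_mem j.2) with hj | hj
    · exact exists_eq_conePolynomial_of_mem_basicTruncatedPowers hj
    · obtain ⟨A, c, p, h, hj⟩ := exists_eq_conePolynomial_of_mem_basicTruncatedPowers hj
      exact ⟨A, c, -p, h.neg, by rw [conePolynomial_neg, ← hj, neg_neg]; rfl⟩
  choose A c p h hj using hterm
  refine ⟨l.length, A, c, p, h, ?_⟩
  rw [← Fin.sum_univ_getElem]
  exact Finset.sum_congr rfl fun j _ => hj j

end Elementary

section Periodicity

variable {s : ℕ}

lemma mem_latticeCone_iff {A : Fin s → Fin s → ℤ} (hA : LinearIndependent ℝ fun i => toReal (A i))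
    {c x : Fin s → ℤ} :
    x ∈ latticeCone A c ↔
      toReal x ∈ realCone A c ∧ x - c ∈ AddSubgroup.closure (Set.range A) := by
  constructor
  · intro hx
    refine ⟨?_, AddSubmonoid.closure_le.2 AddSubgroup.subset_closure
      (mem_latticeCone_iff_sub_mem.1 hx)⟩
    obtain ⟨α, rfl⟩ := hx
    exact ⟨fun i => α i, fun i => Nat.cast_nonneg _, toReal_add_sum_nsmul A c α⟩
  · rintro ⟨⟨α, hα, hx⟩, hxc⟩
    obtain ⟨z, hz⟩ := AddSubgroup.mem_closure_range_iff_of_fintype.1 hxc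
    have hxz : x = c + ∑ i, z i • A i := by rw [← hz, add_sub_cancel]
    have hαz : ∀ i, α i = z i := by
      rw [hxz, toReal_add, toReal_sum_zsmul, add_right_inj] at hx
      exact Fintype.linearIndependent_iffₛ.1 hA _ _ hx.symm
    have hz0 : ∀ i, 0 ≤ z i := fun i => Int.cast_nonneg_iff.1 (hαz i ▸ hα i)
    lift z to Fin s → ℕ using hz0
    exact ⟨z, by simpa only [natCast_zsmul] using hxz⟩

lemma det_ne_zero_of_linearIndependent_toReal {A : Fin s → Fin s → ℤ}
    (hA : LinearIndependent ℝ fun i => toReal (A i)) : (Matrix.of A).det ≠ 0 := by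
  have hdet : ((Matrix.of A).map (Int.castRingHom ℝ)).det ≠ 0 :=
    (Matrix.isUnit_iff_isUnit_det _).1 (Matrix.linearIndependent_rows_iff_isUnit.1 hA) |>.ne_zero
  rwa [← RingHom.mapMatrix_apply, ← RingHom.map_det, eq_intCast, Int.cast_ne_zero] at hdet

lemma det_smul_mem_closure_range (A : Fin s → Fin s → ℤ) (v : Fin s → ℤ) :
    (Matrix.of A).det • v ∈ AddSubgroup.closure (Set.range A) := by
  have h : (Matrix.of A).det • v =
      Matrix.vecMul (Matrix.vecMul v (Matrix.of A).adjugate) (Matrix.of A) := by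
    rw [Matrix.vecMul_vecMul, Matrix.adjugate_mul, Matrix.vecMul_smul, Matrix.vecMul_one]
  rw [h, Matrix.vecMul_eq_sum]
  exact sum_mem fun i _ => zsmul_mem (AddSubgroup.subset_closure (Set.mem_range_self i)) _

/-- The representative in `ℤ^s`, with coordinates in `[0, d)` when `d ≠ 0`, of a residue modulo
`d`. -/
def liftResidue {d : ℕ} (r : Fin s → ZMod d) : Fin s → ℤ := fun k => (r k).cast

lemma exists_sub_liftResidue_eq_smul (d : ℕ) (x : Fin s → ℤ) :
    ∃ v : Fin s → ℤ, x - liftResidue (fun k => (x k : ZMod d)) = (d : ℤ) • v := by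
  have hdvd : ∀ k, (d : ℤ) ∣ x k - ((x k : ZMod d).cast : ℤ) := fun k => by
    rw [← ZMod.intCast_eq_intCast_iff_dvd_sub, ZMod.intCast_zmod_cast]
  choose v hv using hdvd
  exact ⟨v, funext hv⟩

lemma liftResidue_sub_mem_iff {L : AddSubgroup (Fin s → ℤ)} {d : ℕ}
    (hd : ∀ v : Fin s → ℤ, (d : ℤ) • v ∈ L) (c x : Fin s → ℤ) :
    liftResidue (fun k => (x k : ZMod d)) - c ∈ L ↔ x - c ∈ L := by
  obtain ⟨v, hv⟩ := exists_sub_liftResidue_eq_smul d x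
  rw [← L.add_mem_cancel_left (hd v), ← hv, sub_add_sub_cancel]

lemma isPeriodicPiecewisePolynomial_sum_conePolynomial {m D : ℕ} {A : Fin m → Fin s → Fin s → ℤ}
    (hA : ∀ j, LinearIndependent ℝ fun i => toReal (A j i)) (c : Fin m → Fin s → ℤ)
    {p : Fin m → MvPolynomial (Fin s) ℝ} (hp : ∀ j, (p j).totalDegree ≤ D) :
    IsPeriodicPiecewisePolynomial (fun j => realCone (A j) (c j)) D
      (∑ j, conePolynomial (A j) (c j) (p j)) := by
  classical
  let d : ℕ := ∏ j, (Matrix.of (A j)).det.natAbs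
  have hd : 0 < d := Finset.prod_pos fun j _ =>
    Int.natAbs_pos.2 (det_ne_zero_of_linearIndependent_toReal (hA j))
  have hlattice : ∀ j v, (d : ℤ) • v ∈ AddSubgroup.closure (Set.range (A j)) := by
    intro j v
    obtain ⟨q, hq⟩ : (Matrix.of (A j)).det ∣ (d : ℤ) :=
      Int.natAbs_dvd.1 (Int.natCast_dvd_natCast.2 (Finset.dvd_prod_of_mem _ (Finset.mem_univ j)))
    rw [hq, mul_smul]
    exact det_smul_mem_closure_range (A j) (q • v)
  refine ⟨d, hd, fun S => ⟨fun r => ∑ j with j ∈ S ∧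
    liftResidue r - c j ∈ AddSubgroup.closure (Set.range (A j)), p j, fun r => ?_, ?_⟩⟩
  · exact MvPolynomial.totalDegree_finsetSum_le fun j _ => hp j
  rintro x rfl
  have hcell : ∀ j, x ∈ latticeCone (A j) (c j) ↔ j ∈ {j | toReal x ∈ realCone (A j) (c j)} ∧
      liftResidue (fun k => (x k : ZMod d)) - c j ∈ AddSubgroup.closure (Set.range (A j)) :=
    fun j => by rw [mem_latticeCone_iff (hA j), liftResidue_sub_mem_iff (hlattice j)]; rfl
  simp only [Finset.sum_apply, conePolynomial, map_sum, Finset.sum_filter, Set.indicator_apply,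
    hcell, apply_ite (MvPolynomial.eval (toReal x)), map_zero]

end Periodicity

end DiscreteTruncatedPower

open DiscreteTruncatedPower in
theorem theorem3p4 {s N : ℕ} (X : Fin N → Fin s → ℤ)
    (hspan : Submodule.span ℝ (Set.range fun i => toReal (X i)) = ⊤)
    (hX : ∀ u : Fin N → ℝ, (∀ i, 0 ≤ u i) → ∑ i, u i • toReal (X i) = 0 → u = 0) :
    (∀ x, (representations X x).Finite) ∧
    ∃ (m : ℕ) (A : Fin m → Fin s → Fin s → ℤ) (c : Fin m → Fin s → ℤ)
      (p : Fin m → MvPolynomial (Fin s) ℝ),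
      (∀ j, LinearIndependent ℝ fun i => toReal (A j i)) ∧
      (∀ j i, A j i ∈ multiples X) ∧
      (∀ j, c j ∈ latticeCone X 0) ∧
      (∀ j, latticeCone (A j) (c j) ⊆ latticeCone X 0) ∧
      (∀ j, p j ≠ 0 ∧ (p j).totalDegree + s = N) ∧
      (∀ x, (partitionFunction X x : ℝ) =
        ∑ j, (latticeCone (A j) (c j)).indicator
          (fun y => MvPolynomial.eval (toReal y) (p j)) x) ∧
      IsPeriodicPiecewisePolynomial (fun j => realCone (A j) (c j)) (N - s)
        (fun x => (partitionFunction X x : ℝ)) := by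
  have hpointed := isPointed_of_forall_real hX
  obtain ⟨m, A, c, p, h, hsum⟩ :=
    exists_eq_sum_conePolynomial (truncatedPower_mem_closure_basicTruncatedPowers hpointed hspan)
  have hdegree : ∀ j, (p j).totalDegree ≤ N - s := fun j =>
    Nat.le_sub_of_add_le (h j).totalDegree_add.le
  refine ⟨hpointed.finite_representations, m, A, c, p, fun j => (h j).linearIndependent,
    fun j => (h j).mem_multiples, fun j => (h j).apex_mem,
    fun j => latticeCone_subset (h j).mem_multiples (h j).apex_mem,
    fun j => ⟨(h j).ne_zero, (h j).totalDegree_add⟩,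
    fun x => (congrFun hsum x).trans (Finset.sum_apply ..), ?_⟩
  change IsPeriodicPiecewisePolynomial _ _ (truncatedPower X)
  rw [hsum]
  exact isPeriodicPiecewisePolynomial_sum_conePolynomial (fun j => (h j).linearIndependent) c
    hdegree
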